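/- Let $n\ge 2$, let $G\subset\mathbb{R}^n$ be a bounded domain (a nonempty connected open set), let $1\le p<\infty$ and $\delta,\tau\in(0,1)$. Assume that $G$ is a uniform domain or a Lipschitz domain. Then $G$ supports the fractional $(p,p)$-Poincaré inequality: there is a finite constant $c$ such that for every $u\in L^p(G)$ $$\int_G |u(x)-u_G|^p\,dx\le c\int_G\int_{G\cap B^n(x,\tau\operatorname{dist}(x,\partial G))}\frac{|u(x)-u(y)|^p}{|x-y|^{n+\delta p}}\,dy\,dx,$$ where $u_G=\frac1{|G|}\int_G u(x)\,dx$ is the mean value of $u$ over $G$, $B^n(x,r)$ is the open ball with centre $x$ and radius $r$, and the right-hand side may be infinite. Here $G$ is a uniform domain if there is a constant $a\ge 1$ such that any two points $x,y\in G$ can be joined by a rectifiable curve $\gamma:[0,l]\to G$, parametrized by arc length, with $\gamma(0)=x$, $\gamma(l)=y$, $l\le a|x-y|$ and $\min\{t,l-t\}\le a\operatorname{dist}(\gamma(t),\partial G)$ for all $t\in[0,l]$. And $G$ is a Lipschitz domain if every point of $\partial G$ has an open neighbourhood $U$ such that, in suitable Cartesian coordinates $(x',x_n)\in\mathbb{R}^{n-1}\times\mathbb{R}$,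 one has $G\cap U=\{x\in U: x_n>\varphi(x')\}$ for some Lipschitz function $\varphi:\mathbb{R}^{n-1}\to\mathbb{R}$. -/

import Mathlib

open scoped ENNReal NNReal

noncomputable section

namespace FracPoincare

/-- `G` is a uniform domain in `ℝⁿ`: a nonempty connected open set for which there is a constant
`c ≥ 1` such that any two points `x, y` of `G` can be joined in `G` by a rectifiable curve
`γ : [0, l] → G`, parametrized by its arc length, with `l ≤ c |x - y|` and
`min (t, l - t) ≤ c dist (γ t, ∂G)` for all `t ∈ [0, l]`. (The distance to the boundary is
`Metric.infDist`, a true distance as soon as `∂G ≠ ∅`, in particular for bounded `G`.) -/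
structure IsUniformDomain {n : ℕ} (G : Set (EuclideanSpace ℝ (Fin n))) : Prop where
  isOpen : IsOpen G
  isConnected : IsConnected G
  exists_curves : ∃ c : ℝ, 1 ≤ c ∧ ∀ x ∈ G, ∀ y ∈ G,
    ∃ (l : ℝ) (γ : ℝ → EuclideanSpace ℝ (Fin n)),
      0 ≤ l ∧ HasUnitSpeedOn γ (Set.Icc 0 l) ∧ γ 0 = x ∧ γ l = y ∧ l ≤ c * dist x y ∧
      ∀ t ∈ Set.Icc 0 l, γ t ∈ G ∧ min t (l - t) ≤ c * Metric.infDist (γ t) (frontier G)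

/-- `G` is a Lipschitz domain in `ℝⁿ`: a nonempty connected open set such that every boundary
point has an open neighbourhood `U` in which, in suitable Cartesian coordinates, `G` is the set
of points lying above the graph of a Lipschitz function. Here the unit vector `e` is the vertical
direction, the Lipschitz function `φ` is defined on the hyperplane `e^⊥`, and `x` has vertical
coordinate `⟪e, x⟫` and horizontal part the orthogonal projection of `x` to `e^⊥`. -/
structure IsLipschitzDomain {n : ℕ} (G : Set (EuclideanSpace ℝ (Fin n))) : Prop where
  isOpen : IsOpen G
  isConnected : IsConnected G
  locally_epigraph : ∀ z ∈ frontier G,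
    ∃ (U : Set (EuclideanSpace ℝ (Fin n))) (e : EuclideanSpace ℝ (Fin n)) (K : ℝ≥0)
      (φ : (Submodule.span ℝ {e})ᗮ → ℝ),
      IsOpen U ∧ z ∈ U ∧ ‖e‖ = 1 ∧ LipschitzWith K φ ∧
      ∀ x ∈ U, x ∈ G ↔ φ ((Submodule.span ℝ {e})ᗮ.orthogonalProjectionOnto x) < inner ℝ e x

/-- The functional
`∫_G ∫_{G ∩ B(x, τ dist(x, ∂G))} |u(x) - u(y)|^p / |x - y|^(n + δ p) dy dx ∈ [0, ∞]`. -/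
def fracEnergy {n : ℕ} (G : Set (EuclideanSpace ℝ (Fin n))) (p δ τ : ℝ)
    (u : EuclideanSpace ℝ (Fin n) → ℝ) : ℝ≥0∞ :=
  ∫⁻ x in G, ∫⁻ y in G ∩ Metric.ball x (τ * Metric.infDist x (frontier G)),
    ENNReal.ofReal (|u x - u y| ^ p) / ENNReal.ofReal (dist x y ^ ((n : ℝ) + δ * p))

/-- `G` supports the fractional `(q,p)`-Poincaré inequality: there is a finite constant `c` with
`∫_G |u - u_G|^q ≤ c (∫_G ∫_{G ∩ B(x, τ dist(x, ∂G))} |u(x) - u(y)|^p / |x - y|^(n + δ p))^(q/p)`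
for all `u ∈ L^p(G)`, where `u_G` is the mean value of `u` over `G`. Both sides are
`[0, ∞]`-valued integrals. -/
def SupportsFracPoincare {n : ℕ} (G : Set (EuclideanSpace ℝ (Fin n))) (q p δ τ : ℝ) : Prop :=
  ∃ c : ℝ≥0, ∀ u : EuclideanSpace ℝ (Fin n) → ℝ,
    MeasureTheory.MemLp u (ENNReal.ofReal p) (MeasureTheory.volume.restrict G) →
    ∫⁻ x in G, ENNReal.ofReal (|u x - ⨍ y in G, u y| ^ q) ≤ c * fracEnergy G p δ τ u ^ (q / p)

end FracPoincare

end

/-! Only the John condition matters, and bounded uniform and bounded Lipschitz domains satisfy it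
(`IsUniformDomain.isJohn`, `IsLipschitzDomain.isJohn`).

Fix `x ∈ G` and a carrot `γ` from `x` to the centre `x₀`. Average `u` over balls centred at `γ t`
with radius a small multiple of `t`, at scales `t = R l ^ k` with `l < 1` close enough to `1` that
every point of one ball sees the next ball within `τ` times its distance to `∂G`. With `g` the inner
integral of the energy, Jensen's inequality then bounds the `p`-th power of the difference of
consecutive averages by `C t ^ (δ p - n) ∫ g` over the ball. Since `|x - y| ≤ 2 t` there, the
difference is at most `(C I g(x)) ^ (1/p) t ^ (δ/2)`, where `I g(x) = ∫_G g(y) |x - y| ^ (-(n -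
δ/2)) dy` (`exists_enorm_average_sub_le`).

The factors `t ^ (δ/2)` sum geometrically, and by Lebesgue differentiation the averages tend to `u
x` for a.e. `x`. Hence `|u - a| ^ p ≤ C I g` a.e. in `G`, with `a` the average around `x₀`
(`IsJohn.exists_enorm_sub_rpow_le`). The kernel is uniformly integrable over the bounded set `G`, so
Tonelli gives `∫ I g ≤ C ∫ g`. Part of the exponent `δ` pays for the chain, part for the kernel; as
`I` acts on `g` itself, only its `L¹` bound is needed, for every `p ≥ 1`. -/

section FractionalPoincare

open Set Metric Filter Topology MeasureTheory

namespace FracPoincare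

/-! ### Carrots, tubes and the John condition. -/

section Geometry

variable {E : Type*} [NormedAddCommGroup E]

/-- `x` and `y` are joined by a `1`-Lipschitz curve `γ` on `[0, R]` around which the balls
`B(γ t, r t)` lie in `G`. -/
def JoinedWithin (G : Set E) (r : ℝ → ℝ) (R : ℝ) (x y : E) : Prop :=
  ∃ γ : ℝ → E, LipschitzOnWith 1 γ (Icc 0 R) ∧ γ 0 = x ∧ γ R = y ∧
    ∀ t ∈ Icc 0 R, ball (γ t) (r t) ⊆ G

/-- The John condition with centre `x₀`: every point of `G` is joined to `x₀` by a carrot. -/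
def IsJohn (G : Set E) : Prop :=
  ∃ (x₀ : E) (R c : ℝ), 0 < R ∧ 0 < c ∧ ∀ x ∈ G, JoinedWithin G (fun t => c * t) R x x₀

theorem lipschitzOnWith_ite {α β : ℝ → E} {a b : ℝ}
    (hα : LipschitzOnWith 1 α (Icc 0 a)) (hβ : LipschitzOnWith 1 β (Icc 0 b)) (h : α a = β 0) :
    LipschitzOnWith 1 (fun t => if t ≤ a then α t else β (t - a)) (Icc 0 (a + b)) := by
  refine LipschitzOnWith.of_dist_le_mul ?_
  have key : ∀ s t : ℝ, s ∈ Icc 0 (a + b) → t ∈ Icc 0 (a + b) → s ≤ t →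
      dist (if s ≤ a then α s else β (s - a)) (if t ≤ a then α t else β (t - a)) ≤ t - s := by
    intro s t hs ht hst
    have hA : ∀ x ∈ Icc 0 a, ∀ y ∈ Icc 0 a, x ≤ y → dist (α x) (α y) ≤ y - x := by
      intro x hx y hy hxy
      have := hα.dist_le_mul x hx y hy
      rw [Real.dist_eq, abs_sub_comm, abs_of_nonneg (by linarith)] at this
      simpa using this
    have hB : ∀ x ∈ Icc 0 b, ∀ y ∈ Icc 0 b, x ≤ y → dist (β x) (β y) ≤ y - x := by
      intro x hx y hy hxy
      have := hβ.dist_le_mul x hx y hy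
      rw [Real.dist_eq, abs_sub_comm, abs_of_nonneg (by linarith)] at this
      simpa using this
    obtain ⟨hs0, hs1⟩ := hs
    obtain ⟨ht0, ht1⟩ := ht
    split_ifs with h1 h2 h2
    · exact hA s ⟨hs0, h1⟩ t ⟨ht0, h2⟩ hst
    · have e1 := hA s ⟨hs0, h1⟩ a ⟨by linarith, le_rfl⟩ h1
      have e2 := hB 0 ⟨le_rfl, by linarith⟩ (t - a) ⟨by linarith, by linarith⟩ (by linarith)
      rw [h] at e1
      linarith [dist_triangle (α s) (β 0) (β (t - a))]
    · linarith
    · have := hB (s - a) ⟨by linarith, by linarith⟩ (t - a) ⟨by linarith, by linarith⟩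
        (by linarith)
      linarith
  intro s hs t ht
  rw [NNReal.coe_one, one_mul, Real.dist_eq]
  rcases le_total s t with hst | hst
  · rw [abs_sub_comm, abs_of_nonneg (by linarith)]
    exact key s t hs ht hst
  · rw [abs_of_nonneg (by linarith), dist_comm]
    exact key t s ht hs hst

theorem JoinedWithin.trans {G : Set E} {r r' s : ℝ → ℝ} {a b : ℝ} {x y z : E}
    (hb : 0 ≤ b) (h : JoinedWithin G r a x y) (h' : JoinedWithin G r' b y z)
    (ha : 0 ≤ a) (hs : ∀ t ∈ Icc 0 a, s t ≤ r t) (hs' : ∀ t ∈ Icc 0 b, s (a + t) ≤ r' t) :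
    JoinedWithin G s (a + b) x z := by
  obtain ⟨α, hα, hα0, hα1, hαG⟩ := h
  obtain ⟨β, hβ, hβ0, hβ1, hβG⟩ := h'
  refine ⟨_, lipschitzOnWith_ite hα hβ (hα1.trans hβ0.symm), by simp [ha, hα0], ?_, ?_⟩
  · by_cases hb0 : b = 0
    · subst hb0
      simp [hα1, ← hβ1, hβ0]
    · have : ¬ (a + b ≤ a) := by
        have := lt_of_le_of_ne hb (Ne.symm hb0)
        linarith
      simp [this, hβ1]
  · rintro t ⟨ht0, ht1⟩
    by_cases hta : t ≤ a
    · simp only [hta, if_true]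
      exact (ball_subset_ball (hs t ⟨ht0, hta⟩)).trans (hαG t ⟨ht0, hta⟩)
    · simp only [hta, if_false]
      have hm : t - a ∈ Icc 0 b := ⟨by linarith, by linarith⟩
      have := hs' (t - a) hm
      rw [add_sub_cancel] at this
      exact (ball_subset_ball this).trans (hβG _ hm)

theorem JoinedWithin.refl {G : Set E} {r : ℝ → ℝ} {R : ℝ} {x : E}
    (h : ∀ t ∈ Icc 0 R, ball x (r t) ⊆ G) : JoinedWithin G r R x x :=
  ⟨fun _ => x, (LipschitzWith.const' x).lipschitzOnWith, rfl, rfl, h⟩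

theorem le_infDist_frontier {G : Set E} {x : E} {r : ℝ} (hG : IsOpen G)
    (hne : (frontier G).Nonempty) (h : ball x r ⊆ G) : r ≤ infDist x (frontier G) := by
  refine (le_infDist hne).2 fun y hy => ?_
  by_contra! hlt
  exact disjoint_left.1 (disjoint_frontier_iff_isOpen.2 hG) hy (h (by rwa [mem_ball, dist_comm]))

theorem JoinedWithin.const_mono {G : Set E} {c c' R R' : ℝ} {x y : E} (hR : 0 ≤ R) (hRR : R ≤ R')
    (hc : c' ≤ c) (h : JoinedWithin G (fun _ => c) R x y) : JoinedWithin G (fun _ => c') R' x y := by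
  have hy : ball y c ⊆ G := by
    obtain ⟨γ, -, -, h1, h2⟩ := h
    simpa [h1] using h2 R ⟨hR, le_rfl⟩
  have h' : JoinedWithin G (fun _ => c) (R' - R) y y := .refl fun _ _ => hy
  have := JoinedWithin.trans (s := fun _ => c') (by linarith) h h' hR (fun _ _ => hc) (fun _ _ => hc)
  simpa using this

/-- The carrots may consist of an initial part, where the ball radius grows linearly, followed by a
tube. -/
theorem JoinedWithin.trans_tube {G : Set E} {c c' h R : ℝ} {x y z : E} (hh : 0 < h) (hR : 0 ≤ R)
    (hc' : 0 ≤ c') (h₁ : JoinedWithin G (fun t => c * t) h x y)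
    (h₂ : JoinedWithin G (fun _ => c') R y z) :
    JoinedWithin G (fun t => min c (c' / (h + R)) * t) (h + R) x z := by
  refine h₁.trans hR h₂ hh.le (fun t ht => ?_) fun t ht => ?_
  · exact mul_le_mul_of_nonneg_right (min_le_left _ _) ht.1
  · have hpos : 0 < h + R := by positivity
    calc min c (c' / (h + R)) * (h + t) ≤ c' / (h + R) * (h + R) :=
          mul_le_mul (min_le_right _ _) (by linarith [ht.2]) (by linarith [ht.1])
            (by positivity)
      _ = c' := div_mul_cancel₀ _ hpos.ne'

variable [NormedSpace ℝ E]

theorem joinedWithin_segment {G : Set E} {r : ℝ → ℝ} {R : ℝ} {x y : E} (hR : 0 < R)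
    (hxy : dist x y ≤ R) (h : ∀ t ∈ Icc 0 R, ball (x + (t / R) • (y - x)) (r t) ⊆ G) :
    JoinedWithin G r R x y := by
  refine ⟨fun t => x + (t / R) • (y - x), LipschitzOnWith.of_dist_le_mul ?_, by simp,
    by simp [hR.ne'], h⟩
  intro s _ t _
  rw [dist_add_left, dist_eq_norm, ← sub_smul, norm_smul, NNReal.coe_one, one_mul, ← sub_div,
    Real.norm_eq_abs, abs_div, abs_of_pos hR, Real.dist_eq, div_mul_eq_mul_div, div_le_iff₀ hR,
    ← dist_eq_norm, dist_comm y x]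
  gcongr

/-- A segment inside the ball around `x` is prepended to the tube starting at `x'`; the resulting
length and width do not depend on `y`. -/
theorem exists_joinedWithin_nhds {G : Set E} {x₀ x' x : E} {ρ c R : ℝ} (hρ : 0 < ρ)
    (hR : 0 ≤ R) (hc : 0 < c)
    (hG : ball x (2 * ρ) ⊆ G) (hx : dist x' x < ρ) (h : JoinedWithin G (fun _ => c) R x' x₀) :
    ∃ ε > 0, ∃ R' ≥ 0, ∃ c' > 0, ∀ y ∈ ball x ε, JoinedWithin G (fun _ => c') R' y x₀ := by
  refine ⟨ρ, hρ, 2 * ρ + R, by positivity, min ρ c, by positivity, fun y hy => ?_⟩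
  have hseg : JoinedWithin G (fun _ => ρ) (2 * ρ) y x' := by
    refine joinedWithin_segment (by positivity) ?_ fun t ht => ?_
    · rw [mem_ball] at hy
      linarith [dist_triangle_right y x' x]
    · refine Subset.trans (ball_subset_ball' ?_) hG
      have hmem : y + (t / (2 * ρ)) • (x' - y) ∈ ball x ρ :=
        (convex_ball x ρ).add_smul_sub_mem hy (mem_ball.2 hx)
          ⟨div_nonneg ht.1 (by positivity), div_le_one_of_le₀ ht.2 (by positivity)⟩
      rw [mem_ball] at hmem
      linarith
  exact hseg.trans hR h (by positivity) (fun _ _ => min_le_left _ _) (fun _ _ => min_le_right _ _)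

/-- Points of a compact subset of a domain are joined to a given point by tubes of uniform length
and width. -/
theorem exists_joinedWithin_of_isCompact {G K : Set E} (hG : IsOpen G) (hGc : IsPreconnected G)
    {x₀ : E} (hx₀ : x₀ ∈ G) (hK : IsCompact K) (hKG : K ⊆ G) :
    ∃ R ≥ 0, ∃ c > 0, ∀ x ∈ K, JoinedWithin G (fun _ => c) R x x₀ := by
  have hball : ∀ x ∈ G, ∃ ρ > 0, ball x (2 * ρ) ⊆ G := by
    intro x hx
    obtain ⟨ε, hε, h⟩ := Metric.isOpen_iff.1 hG x hx
    exact ⟨ε / 2, by positivity, by rwa [mul_div_cancel₀ _ two_ne_zero]⟩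
  let S : Set E := {x | ∃ ε > 0, ∃ R' ≥ 0, ∃ c' > 0, ∀ y ∈ ball x ε,
    JoinedWithin G (fun _ => c') R' y x₀}
  have hGS : G ⊆ S := by
    -- Connectedness: `S` is open, contains `x₀`, and is closed relative to `G`.
    refine hGc.subset_of_closure_inter_subset ?_ ⟨x₀, hx₀, ?_⟩ ?_
    · refine Metric.isOpen_iff.2 ?_
      rintro x ⟨ε, hε, R, hR, c, hc, h⟩
      refine ⟨ε / 2, by positivity, fun y hy => ⟨ε / 2, by positivity, R, hR, c, hc,
        fun z hz => h z ?_⟩⟩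
      rw [mem_ball] at *
      linarith [dist_triangle z y x]
    · obtain ⟨ρ, hρ, h⟩ := hball x₀ hx₀
      refine exists_joinedWithin_nhds hρ le_rfl hρ h (by simpa using hρ) (.refl fun _ _ => ?_)
      exact (ball_subset_ball (by linarith)).trans h
    · rintro x ⟨hx, hxG⟩
      obtain ⟨ρ, hρ, h⟩ := hball x hxG
      obtain ⟨x', ⟨ε, hε, R, hR, c, hc, h'⟩, hx'⟩ := Metric.mem_closure_iff.1 hx ρ hρ
      exact exists_joinedWithin_nhds hρ hR hc h (by rwa [dist_comm]) (h' x' (mem_ball_self hε))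
  refine hK.induction_on (p := fun s => ∃ R ≥ 0, ∃ c > 0, ∀ x ∈ s,
    JoinedWithin G (fun _ => c) R x x₀) ⟨0, le_rfl, 1, one_pos, by simp⟩ ?_ ?_ ?_
  · rintro s t hst ⟨R, hR, c, hc, h⟩
    exact ⟨R, hR, c, hc, fun x hx => h x (hst hx)⟩
  · rintro s t ⟨R, hR, c, hc, h⟩ ⟨R', hR', c', hc', h'⟩
    refine ⟨max R R', le_max_of_le_left hR, min c c', lt_min hc hc', ?_⟩
    rintro x (hx | hx)
    · exact (h x hx).const_mono hR (le_max_left _ _) (min_le_left _ _)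
    · exact (h' x hx).const_mono hR' (le_max_right _ _) (min_le_right _ _)
  · intro x hx
    obtain ⟨ε, hε, R, hR, c, hc, h⟩ := hGS (hKG hx)
    exact ⟨ball x ε, mem_nhdsWithin_of_mem_nhds (ball_mem_nhds x hε), R, hR, c, hc, h⟩

theorem ball_subset_of_le_infDist_frontier {G : Set E} {x : E} {r : ℝ} (hG : IsOpen G)
    (hx : x ∈ G) (h : r ≤ infDist x (frontier G)) : ball x r ⊆ G := by
  rcases le_or_gt r 0 with hr | hr
  · simp [ball_eq_empty.2 hr]
  refine (convex_ball x r).isPreconnected.subset_of_closure_inter_subset hG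
    ⟨x, mem_ball_self hr, hx⟩ ?_
  rintro y ⟨hy, hyr⟩
  by_contra hyG
  have := infDist_le_dist_of_mem (x := x) (hG.frontier_eq ▸ ⟨hy, hyG⟩ : y ∈ frontier G)
  rw [mem_ball, dist_comm] at hyr
  linarith

theorem frontier_nonempty_of_isBounded [Nontrivial E] {G : Set E} (hne : G.Nonempty)
    (hb : Bornology.IsBounded G) : (frontier G).Nonempty := by
  refine nonempty_frontier_iff.2 ⟨hne, ?_⟩
  rintro rfl
  exact NormedSpace.unbounded_univ ℝ E hb

/-- A bounded domain is a John domain as soon as, near its boundary, a point can be moved away from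
the boundary along a segment at a linear rate. -/
theorem isJohn_of_forall_near_frontier [FiniteDimensional ℝ E] {G : Set E} (hG : IsOpen G)
    (hGc : IsConnected G) (hGb : Bornology.IsBounded G) {h c : ℝ} (hh : 0 < h) (hc : 0 < c)
    (H : ∀ x ∈ G, (∃ z ∈ frontier G, dist x z < h) →
      ∃ e : E, ‖e‖ = 1 ∧ ∀ t ∈ Icc 0 h, ball (x + t • e) (c * t) ⊆ G) :
    IsJohn G := by
  obtain ⟨x₀, hx₀⟩ := hGc.nonempty
  -- A ball of radius `κ` fits around the end of each initial piece: radius `c * h` after a segment,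
  -- radius `h` for a point already far from the boundary. The centres of such balls form a compact
  -- subset of `G`, to which uniform tubes apply.
  set κ := min h (c * h) with hκ
  have hκ0 : 0 < κ := by positivity
  have hKcl : IsClosed {y | ball y κ ⊆ G} := by
    have : {y | ball y κ ⊆ G} = ⋂ w ∈ Gᶜ, {y | κ ≤ dist w y} := by
      ext y
      simp only [mem_ofPred_eq, mem_iInter, subset_def, mem_ball, mem_compl_iff]
      exact forall_congr' fun w => by rw [← not_lt, not_imp_not]
    rw [this]
    exact isClosed_biInter fun w _ => isClosed_le continuous_const (by fun_prop)
  have hKG : {y | ball y κ ⊆ G} ⊆ G := fun y hy => hy (mem_ball_self hκ0)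
  have hK : IsCompact {y | ball y κ ⊆ G} :=
    haveI := FiniteDimensional.proper ℝ E
    Metric.isCompact_of_isClosed_isBounded hKcl (hGb.subset hKG)
  obtain ⟨R, hR, c', hc', hT⟩ :=
    exists_joinedWithin_of_isCompact hG hGc.isPreconnected hx₀ hK hKG
  refine ⟨x₀, h + R, min (min c 1) (c' / (h + R)), by positivity, by positivity, fun x hx => ?_⟩
  have hstart : ∃ y ∈ {y | ball y κ ⊆ G}, JoinedWithin G (fun t => min c 1 * t) h x y := by
    by_cases hn : ∃ z ∈ frontier G, dist x z < h
    · obtain ⟨e, he, hseg⟩ := H x hx hn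
      refine ⟨x + h • e, ?_, joinedWithin_segment hh ?_ fun t ht => ?_⟩
      · exact (ball_subset_ball (min_le_right _ _)).trans (hseg h ⟨hh.le, le_rfl⟩)
      · simp [norm_smul, he, abs_of_pos hh]
      · rw [add_sub_cancel_left, smul_smul, div_mul_cancel₀ _ hh.ne']
        exact (ball_subset_ball (mul_le_mul_of_nonneg_right (min_le_left _ _) ht.1)).trans
          (hseg t ht)
    -- Far from the boundary the constant curve serves; the factor `min c 1` keeps its balls within
    -- radius `h`.
    · push Not at hn
      have hb : ball x h ⊆ G := by
        rcases (frontier G).eq_empty_or_nonempty with he | hne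
        · have : G = univ := by
            by_contra hcon
            exact (nonempty_frontier_iff.2 ⟨⟨x, hx⟩, hcon⟩).ne_empty he
          simp [this]
        · exact ball_subset_of_le_infDist_frontier hG hx ((le_infDist hne).2 hn)
      refine ⟨x, (ball_subset_ball (min_le_left _ _)).trans hb, .refl fun t ht => ?_⟩
      refine (ball_subset_ball ?_).trans hb
      calc min c 1 * t ≤ 1 * h := mul_le_mul (min_le_right _ _) ht.2 ht.1 zero_le_one
        _ = h := one_mul h
  obtain ⟨y, hy, hxy⟩ := hstart
  exact hxy.trans_tube hh hR hc'.le (hT y hy)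

end Geometry

/-! ### Bounded uniform and Lipschitz domains are John domains. -/

section Domains

variable {n : ℕ} {G : Set (EuclideanSpace ℝ (Fin n))}

/-- The curve from `x` to a fixed `x₀` is a cigar, thin at both ends. Its thin end at `x₀` is
harmless because a fixed ball around `x₀` lies in `G`. -/
theorem IsUniformDomain.isJohn (h : IsUniformDomain G) (hb : Bornology.IsBounded G) :
    IsJohn G := by
  obtain ⟨x₀, hx₀⟩ := h.isConnected.nonempty
  obtain ⟨a, ha, hcurve⟩ := h.exists_curves
  obtain ⟨d, hd, hball⟩ := Metric.isOpen_iff.1 h.isOpen x₀ hx₀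
  obtain ⟨D, hD, hdiam⟩ : ∃ D > 0, ∀ x ∈ G, dist x x₀ ≤ D := by
    obtain ⟨D, hD⟩ := hb.subset_closedBall x₀
    exact ⟨max D 1, by positivity, fun x hx => (hD hx).trans (le_max_left _ _)⟩
  have ha0 : 0 < a := by linarith
  set L := a * D with hL
  have hL0 : 0 < L := by positivity
  -- The first bound handles `min t (l - t) = t`. The second keeps `c * t ≤ d / (2 * a)` up to time
  -- `L`, which handles `l - t > d / 2` as well as the part near `x₀`.
  set c := min (1 / a) (d / (2 * a * L)) with hc
  have hc0 : 0 < c := by positivity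
  have hcd : c * L ≤ d / 2 / a := by
    calc c * L ≤ d / (2 * a * L) * L := mul_le_mul_of_nonneg_right (min_le_right _ _) hL0.le
      _ = d / 2 / a := by field_simp
  have hda : d / 2 / a ≤ d / 2 := div_le_self (by positivity) ha
  refine ⟨x₀, L, c, hL0, hc0, fun x hx => ?_⟩
  obtain ⟨l, γ, hl, hspeed, h0, h1, hlen, hcig⟩ := hcurve x hx x₀ hx₀
  have hlL : l ≤ L := hlen.trans (mul_le_mul_of_nonneg_left (hdiam x hx) ha0.le)
  have hdist : ∀ s ∈ Icc 0 l, ∀ t ∈ Icc 0 l, s ≤ t → dist (γ s) (γ t) ≤ t - s := by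
    intro s hs t ht hst
    have h := hasConstantSpeedOnWith_iff_ordered.1 hspeed hs ht hst
    rw [NNReal.coe_one, one_mul] at h
    have := eVariationOn.edist_le γ (s := Icc 0 l ∩ Icc s t) ⟨hs, le_rfl, hst⟩ ⟨ht, hst, le_rfl⟩
    rwa [h, edist_dist, ENNReal.ofReal_le_ofReal_iff (by linarith)] at this
  have hlip : LipschitzOnWith 1 γ (Icc 0 l) := by
    refine LipschitzOnWith.of_dist_le_mul fun s hs t ht => ?_
    rw [NNReal.coe_one, one_mul, Real.dist_eq]
    rcases le_total s t with hst | hst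
    · rw [abs_sub_comm, abs_of_nonneg (by linarith)]
      exact hdist s hs t ht hst
    · rw [abs_of_nonneg (by linarith), dist_comm]
      exact hdist t ht s hs hst
  have hγ : JoinedWithin G (fun t => c * t) l x x₀ := by
    refine ⟨γ, hlip, h0, h1, fun t ht => ?_⟩
    obtain ⟨hmem, hmin⟩ := hcig t ht
    have hle : min t (l - t) / a ≤ infDist (γ t) (frontier G) := by
      rwa [div_le_iff₀' ha0]
    have hct : c * t ≤ d / 2 / a :=
      (mul_le_mul_of_nonneg_left (ht.2.trans hlL) hc0.le).trans hcd
    by_cases hend : l - t ≤ d / 2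
    · refine Subset.trans (ball_subset_ball' ?_) hball
      have := hdist t ht l ⟨hl, le_rfl⟩ ht.2
      rw [h1] at this
      linarith
    · refine ball_subset_of_le_infDist_frontier h.isOpen hmem (le_trans ?_ hle)
      rcases min_cases t (l - t) with ⟨e, -⟩ | ⟨e, -⟩ <;> rw [e]
      · calc c * t ≤ 1 / a * t := mul_le_mul_of_nonneg_right (min_le_left _ _) ht.1
          _ = t / a := by ring
      · exact hct.trans (by gcongr; linarith)
  -- Waiting at `x₀` makes the parameter length independent of `x`.
  have hrest : JoinedWithin G (fun _ => d) (L - l) x₀ x₀ := .refl fun _ _ => hball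
  have := JoinedWithin.trans (s := fun t => c * t) (by linarith) hγ hrest hl (fun _ _ => le_rfl)
    fun t ht => by
      have : c * (l + t) ≤ c * L := mul_le_mul_of_nonneg_left (by linarith [ht.2]) hc0.le
      linarith
  simpa using this

/-- Above a Lipschitz graph, moving up in the chart direction stays inside a cone contained in the
epigraph. Compactness of the boundary makes the constants uniform. -/
theorem IsLipschitzDomain.exists_segments (h : IsLipschitzDomain G)
    (hb : Bornology.IsBounded G) :
    ∃ r > 0, ∃ c > 0, ∀ x ∈ G, (∃ z ∈ frontier G, dist x z < r) →
      ∃ e : EuclideanSpace ℝ (Fin n), ‖e‖ = 1 ∧ ∀ t ∈ Icc 0 r, ball (x + t • e) (c * t) ⊆ G := by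
  have hcomp : IsCompact (frontier G) :=
    Metric.isCompact_of_isClosed_isBounded isClosed_frontier
      (hb.closure.subset frontier_subset_closure)
  refine hcomp.induction_on (p := fun s => ∃ r > 0, ∃ c > 0, ∀ x ∈ G, (∃ z ∈ s, dist x z < r) →
      ∃ e : EuclideanSpace ℝ (Fin n), ‖e‖ = 1 ∧ ∀ t ∈ Icc 0 r, ball (x + t • e) (c * t) ⊆ G)
    ⟨1, one_pos, 1, one_pos, by simp⟩ ?_ ?_ ?_
  · rintro s t hst ⟨r, hr, c, hc, H⟩
    exact ⟨r, hr, c, hc, fun x hx ⟨z, hz, hxz⟩ => H x hx ⟨z, hst hz, hxz⟩⟩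
  · rintro s s' ⟨r, hr, c, hc, H⟩ ⟨r', hr', c', hc', H'⟩
    refine ⟨min r r', by positivity, min c c', by positivity, ?_⟩
    rintro x hx ⟨z, hz | hz, hxz⟩
    · obtain ⟨e, he, hs⟩ := H x hx ⟨z, hz, hxz.trans_le (min_le_left _ _)⟩
      exact ⟨e, he, fun t ht => (ball_subset_ball (mul_le_mul_of_nonneg_right (min_le_left _ _)
        ht.1)).trans (hs t ⟨ht.1, ht.2.trans (min_le_left _ _)⟩)⟩
    · obtain ⟨e, he, hs⟩ := H' x hx ⟨z, hz, hxz.trans_le (min_le_right _ _)⟩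
      exact ⟨e, he, fun t ht => (ball_subset_ball (mul_le_mul_of_nonneg_right (min_le_right _ _)
        ht.1)).trans (hs t ⟨ht.1, ht.2.trans (min_le_right _ _)⟩)⟩
  · intro z hz
    obtain ⟨U, e, K, φ, hU, hzU, he, hφ, hiff⟩ := h.locally_epigraph z hz
    obtain ⟨ε, hε, hball⟩ := Metric.isOpen_iff.1 hU z hzU
    set ρ := ε / 4 with hρ
    have hρ0 : 0 < ρ := by positivity
    -- With `ρ = ε / 4`, starting within `2 * ρ` of `z`, rising by at most `ρ` and perturbing by
    -- less than `ρ` stays in the chart. A perturbation `v` costs at most `‖v‖` in height and `K *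
    -- ‖v‖` in the graph, against a gain of `t`; hence the slope `1 / (1 + K)`.
    refine ⟨ball z ρ, mem_nhdsWithin_of_mem_nhds (ball_mem_nhds z hρ0), ρ, hρ0, 1 / (1 + K),
      by positivity, ?_⟩
    rintro x hx ⟨w, hw, hxw⟩
    refine ⟨e, he, fun t ht y hy => ?_⟩
    rw [mem_ball] at hw hy
    have hxz : dist x z < 2 * ρ := by linarith [dist_triangle x w z]
    have hK : (1 : ℝ) / (1 + K) ≤ 1 := div_le_one_of_le₀ (by simp) (by positivity)
    have hkt : 1 / (1 + K) * t ≤ t := mul_le_of_le_one_left ht.1 hK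
    have hxU : x ∈ U := hball (by rw [mem_ball]; linarith)
    have hyU : y ∈ U := by
      refine hball ?_
      rw [mem_ball]
      have h1 := dist_triangle y (x + t • e) z
      have h2 := dist_triangle (x + t • e) x z
      have h3 : dist (x + t • e) x = t := by simp [norm_smul, he, abs_of_nonneg ht.1]
      linarith [ht.2]
    have hxG := (hiff x hxU).1 hx
    refine (hiff y hyU).2 ?_
    set P := (Submodule.span ℝ {e})ᗮ.orthogonalProjectionOnto with hP
    have hPe : P e = 0 := by
      rw [hP, Submodule.orthogonalProjectionOnto_eq_zero_iff]
      exact Submodule.le_orthogonal_orthogonal _ (Submodule.mem_span_singleton_self e)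
    have hw : y = x + t • e + (y - (x + t • e)) := by abel
    set v := y - (x + t • e) with hv
    have hvn : ‖v‖ < 1 / (1 + K) * t := by rwa [hv, ← dist_eq_norm]
    have hPy : P y = P x + P v := by
      rw [hw]
      simp [hPe]
    have hφy : φ (P y) ≤ φ (P x) + K * ‖v‖ := by
      have h1 := hφ.dist_le_mul (P y) (P x)
      have h2 : dist (P y) (P x) ≤ ‖v‖ := by
        rw [hPy, dist_eq_norm, add_sub_cancel_left]
        exact Submodule.norm_orthogonalProjectionOnto_apply_le _ v
      have h3 := (le_abs_self _).trans ((Real.dist_eq _ _).symm.le.trans h1)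
      have h4 := mul_le_mul_of_nonneg_left h2 K.coe_nonneg
      linarith
    have hin : inner ℝ e y = inner ℝ e x + t + inner ℝ e v := by
      rw [hw, inner_add_right, inner_add_right, inner_smul_right, real_inner_self_eq_norm_sq, he]
      ring
    have hev : -‖v‖ ≤ inner ℝ e v := by
      have := abs_real_inner_le_norm e v
      rw [he, one_mul] at this
      exact (abs_le.1 this).1
    have hfin : (1 + K) * ‖v‖ < t := by
      have := mul_lt_mul_of_pos_left hvn (show (0 : ℝ) < 1 + K by positivity)
      rwa [← mul_assoc, mul_one_div_cancel (by positivity), one_mul] at this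
    rw [hin]
    linarith

theorem IsLipschitzDomain.isJohn (h : IsLipschitzDomain G) (hb : Bornology.IsBounded G) :
    IsJohn G := by
  obtain ⟨r, hr, c, hc, H⟩ := h.exists_segments hb
  exact isJohn_of_forall_near_frontier h.isOpen h.isConnected hb hr hc H

end Domains

/-! ### Jensen-type estimates for mean values. -/

section MeanValues

/-- Jensen's inequality, obtained from `L¹ ≤ L^p` for the normalized measure. -/
theorem enorm_average_sub_rpow_le {α : Type*} [MeasurableSpace α] {μ : Measure α}
    [IsFiniteMeasure μ] [NeZero μ] {f : α → ℝ} (hf : Integrable f μ) (a : ℝ) {p : ℝ}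
    (hp : 1 ≤ p) :
    ‖(⨍ x, f x ∂μ) - a‖ₑ ^ p ≤ (μ univ)⁻¹ * ∫⁻ x, ‖f x - a‖ₑ ^ p ∂μ := by
  set ν := (μ univ)⁻¹ • μ with hν
  have hfν : Integrable f ν := hf.smul_measure (by simp [NeZero.ne])
  have h1 : (⨍ x, f x ∂μ) - a = ∫ x, (f x - a) ∂ν := by
    rw [integral_sub hfν (integrable_const a)]
    simp [average, hν]
  have h2 : (∫⁻ x, ‖f x - a‖ₑ ∂ν) ≤ (∫⁻ x, ‖f x - a‖ₑ ^ p ∂ν) ^ (1 / p) := by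
    have hp' : (ENNReal.ofReal p).toReal = p := ENNReal.toReal_ofReal (by linarith)
    have := eLpNorm_le_eLpNorm_of_exponent_le (μ := ν) (f := fun x => f x - a)
      (ENNReal.one_le_ofReal.2 hp) (hfν.sub (integrable_const a)).aestronglyMeasurable
    rwa [eLpNorm_one_eq_lintegral_enorm, eLpNorm_eq_lintegral_rpow_enorm_toReal (by simp; linarith)
      ENNReal.ofReal_ne_top, hp'] at this
  calc ‖(⨍ x, f x ∂μ) - a‖ₑ ^ p ≤ ((∫⁻ x, ‖f x - a‖ₑ ^ p ∂ν) ^ (1 / p)) ^ p := by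
        rw [h1]
        gcongr
        exact (enorm_integral_le_lintegral_enorm _).trans h2
    _ = ∫⁻ x, ‖f x - a‖ₑ ^ p ∂ν := by
        rw [← ENNReal.rpow_mul, one_div_mul_cancel (by linarith), ENNReal.rpow_one]
    _ = _ := by rw [hν, lintegral_smul_measure, smul_eq_mul]

/-- The mean is an almost optimal constant, so the chain may end at any convenient `a`. -/
theorem lintegral_enorm_sub_average_rpow_le {α : Type*} [MeasurableSpace α] {μ : Measure α}
    [IsFiniteMeasure μ] [NeZero μ] {f : α → ℝ} (hf : Integrable f μ) (a : ℝ) {p : ℝ}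
    (hp : 1 ≤ p) :
    ∫⁻ x, ‖f x - ⨍ y, f y ∂μ‖ₑ ^ p ∂μ ≤ 2 ^ p * ∫⁻ x, ‖f x - a‖ₑ ^ p ∂μ := by
  set m := ⨍ y, f y ∂μ
  set J := ∫⁻ x, ‖f x - a‖ₑ ^ p ∂μ with hJ
  have hm : AEMeasurable (fun x => ‖f x - a‖ₑ ^ p) μ := by
    have := hf.aemeasurable
    fun_prop
  have hpt : ∀ x, ‖f x - m‖ₑ ^ p ≤ 2 ^ (p - 1) * (‖f x - a‖ₑ ^ p + ‖m - a‖ₑ ^ p) := by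
    intro x
    refine le_trans ?_ (ENNReal.rpow_add_le_mul_rpow_add_rpow _ _ hp)
    gcongr
    have : f x - m = (f x - a) - (m - a) := by ring
    rw [this]
    exact enorm_sub_le
  have htop : (2 : ℝ≥0∞) ^ (p - 1) ≠ ∞ := by simp
  calc ∫⁻ x, ‖f x - m‖ₑ ^ p ∂μ
      ≤ ∫⁻ x, 2 ^ (p - 1) * (‖f x - a‖ₑ ^ p + ‖m - a‖ₑ ^ p) ∂μ := lintegral_mono hpt
    _ = 2 ^ (p - 1) * (J + ‖m - a‖ₑ ^ p * μ univ) := by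
        rw [lintegral_const_mul' _ _ htop, lintegral_add_right _ measurable_const, lintegral_const]
    _ ≤ 2 ^ (p - 1) * (J + (μ univ)⁻¹ * J * μ univ) := by
        gcongr
        exact enorm_average_sub_rpow_le hf a hp
    _ = 2 ^ (p - 1) * (J + J) := by
        rw [mul_comm _ J, mul_assoc, ENNReal.inv_mul_cancel (by simp [NeZero.ne]) (by simp),
          mul_one]
    _ = 2 ^ p * J := by
        have : (2 : ℝ≥0∞) ^ p = 2 ^ (p - 1) * 2 := by
          nth_rewrite 3 [← ENNReal.rpow_one 2]
          rw [← ENNReal.rpow_add _ _ two_ne_zero ENNReal.ofNat_ne_top, sub_add_cancel]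
        rw [this, ← two_mul, mul_assoc]

/-- The difference of two mean values is controlled by a fractional energy. -/
theorem enorm_average_sub_average_rpow_le {X : Type*} [MetricSpace X] [MeasurableSpace X]
    {μ : Measure X} {A B : Set X} (hA : MeasurableSet A) (hB : MeasurableSet B)
    (hA0 : μ A ≠ 0) (hB0 : μ B ≠ 0) (hA1 : μ A ≠ ∞) (hB1 : μ B ≠ ∞) {u : X → ℝ}
    (huA : IntegrableOn u A μ) (huB : IntegrableOn u B μ) {p s : ℝ} (hp : 1 ≤ p) (hs : 0 < s)
    {D : ℝ≥0∞} (hD : D ≠ ∞) (hAB : ∀ x ∈ A, ∀ y ∈ B, edist x y ≤ D) {S : X → Set X}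
    (hS : ∀ x ∈ A, B ⊆ S x) :
    ‖(⨍ x in A, u x ∂μ) - ⨍ y in B, u y ∂μ‖ₑ ^ p ≤ (μ A)⁻¹ * ((μ B)⁻¹ * (D ^ s *
      ∫⁻ x in A, ∫⁻ y in S x, ‖u x - u y‖ₑ ^ p / edist x y ^ s ∂μ ∂μ)) := by
  have : IsFiniteMeasure (μ.restrict A) := ⟨by simpa using hA1.lt_top⟩
  have : IsFiniteMeasure (μ.restrict B) := ⟨by simpa using hB1.lt_top⟩
  have : NeZero (μ.restrict A) := ⟨by simpa using hA0⟩
  have : NeZero (μ.restrict B) := ⟨by simpa using hB0⟩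
  have hDs : D ^ s ≠ ∞ := by simp [hD, hs.le]
  -- Jensen on `A`, then on `B` for each fixed `x ∈ A`; the kernel enters through `edist x y ≤ D`.
  refine (enorm_average_sub_rpow_le huA _ hp).trans ?_
  rw [Measure.restrict_apply_univ]
  gcongr
  rw [← lintegral_const_mul' _ _ hDs, ← lintegral_const_mul' _ _ (by simpa using hB0)]
  refine setLIntegral_mono' hA fun x hx => ?_
  rw [enorm_sub_rev]
  refine (enorm_average_sub_rpow_le huB _ hp).trans ?_
  rw [Measure.restrict_apply_univ]
  gcongr
  rw [← lintegral_const_mul' _ _ hDs]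
  refine (setLIntegral_mono' hB fun y hy => ?_).trans (lintegral_mono_set (hS x hx))
  rw [enorm_sub_rev]
  rcases eq_or_ne x y with rfl | hxy
  · simp [show 0 < p by linarith]
  · have h0 : edist x y ^ s ≠ 0 := by
      simp [hxy, hs]
    have h1 : edist x y ^ s ≠ ∞ := by simp [hs.le, edist_ne_top]
    calc ‖u x - u y‖ₑ ^ p = edist x y ^ s * (‖u x - u y‖ₑ ^ p / edist x y ^ s) :=
          (ENNReal.mul_div_cancel h0 h1).symm
      _ ≤ _ := by
          gcongr
          exact hAB x hx y hy

end MeanValues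

/-! ### Uniform integrability of the Riesz kernel on bounded sets. -/

section RieszPotential

variable {n : ℕ}

theorem exists_lintegral_edist_rpow_le (hn : 1 ≤ n) {G : Set (EuclideanSpace ℝ (Fin n))}
    (hG : Bornology.IsBounded G) {α : ℝ} (hα : α < n) :
    ∃ C : ℝ≥0, ∀ y ∈ G, ∫⁻ x in G, edist x y ^ (-α) ≤ C := by
  obtain ⟨D, hD⟩ : ∃ D : ℝ, ∀ y ∈ G, ∀ x ∈ G, dist x y < D := by
    obtain ⟨D, hD⟩ := Metric.isBounded_iff.1 hG
    exact ⟨D + 1, fun y hy x hx => by linarith [hD hx hy]⟩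
  have hfin : ∫⁻ x in ball (0 : EuclideanSpace ℝ (Fin n)) D, ‖x‖ₑ ^ (-α) < ∞ := by
    have h := integrableOn_ball_of_norm_le_rpow (E := EuclideanSpace ℝ (Fin n)) (μ := volume)
      (f := fun x => ‖x‖ ^ (-α)) (C := 1) (α := α) (r := D) (by simpa using hn) (by simpa using hα)
      (Eventually.of_forall fun x => by
        rw [one_mul, Real.norm_of_nonneg (by positivity)])
      (Measurable.aestronglyMeasurable (by fun_prop))
    refine lt_of_eq_of_lt ?_ h.2
    refine lintegral_congr_ae (ae_restrict_of_ae ?_)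
    -- The real and the extended powers of the norm can disagree at the origin (`0` against `∞` when
    -- `α > 0`), which is a null set.
    have : Nontrivial (EuclideanSpace ℝ (Fin n)) :=
      Module.nontrivial_of_finrank_pos (R := ℝ) (by rwa [finrank_euclideanSpace_fin])
    filter_upwards [compl_mem_ae_iff.2 (measure_singleton (0 : EuclideanSpace ℝ (Fin n)))] with x hx
    rw [Real.enorm_of_nonneg (by positivity),
      ← ENNReal.ofReal_rpow_of_pos (norm_pos_iff.2 hx), ofReal_norm]
  refine ⟨_, fun y hy => le_trans ?_ (ENNReal.coe_toNNReal hfin.ne).ge⟩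
  calc ∫⁻ x in G, edist x y ^ (-α) ≤ ∫⁻ x in ball y D, edist x y ^ (-α) :=
        lintegral_mono_set fun x hx => hD y hy x hx
    _ = ∫⁻ x in ball (0 : EuclideanSpace ℝ (Fin n)) D, ‖x‖ₑ ^ (-α) := by
        rw [← lintegral_indicator measurableSet_ball, ← lintegral_indicator measurableSet_ball,
          ← lintegral_sub_right_eq_self (Set.indicator (ball 0 D) _) y]
        refine lintegral_congr fun x => ?_
        simp [indicator, dist_eq_norm, edist_eq_enorm_sub]

end RieszPotential

/-! ### Chaining along carrots: the pointwise bound by a potential. -/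

section PointwiseBound

variable {n : ℕ} {G : Set (EuclideanSpace ℝ (Fin n))} {p δ τ : ℝ}

/-- The inner integral in `fracEnergy`. -/
noncomputable def energyDensity (G : Set (EuclideanSpace ℝ (Fin n))) (p δ τ : ℝ)
    (u : EuclideanSpace ℝ (Fin n) → ℝ) (x : EuclideanSpace ℝ (Fin n)) : ℝ≥0∞ :=
  ∫⁻ y in G ∩ ball x (τ * infDist x (frontier G)), ‖u x - u y‖ₑ ^ p / edist x y ^ (n + δ * p)

/-- The fractional Riesz potential of the energy density. -/
noncomputable def energyPotential (G : Set (EuclideanSpace ℝ (Fin n))) (p δ τ : ℝ)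
    (u : EuclideanSpace ℝ (Fin n) → ℝ) (x : EuclideanSpace ℝ (Fin n)) : ℝ≥0∞ :=
  ∫⁻ y in G, energyDensity G p δ τ u y * edist x y ^ (-(n - δ / 2))

theorem ofReal_abs_rpow (hp : 0 ≤ p) (a : ℝ) : ENNReal.ofReal (|a| ^ p) = ‖a‖ₑ ^ p := by
  rw [← ENNReal.ofReal_rpow_of_nonneg (abs_nonneg a) hp, ← Real.norm_eq_abs, ofReal_norm]

theorem fracEnergy_eq_lintegral_energyDensity (hp : 0 ≤ p) (hδ : 0 ≤ δ)
    (u : EuclideanSpace ℝ (Fin n) → ℝ) :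
    fracEnergy G p δ τ u = ∫⁻ x in G, energyDensity G p δ τ u x := by
  unfold fracEnergy energyDensity
  refine lintegral_congr fun x => lintegral_congr fun y => ?_
  rw [ofReal_abs_rpow hp, ← ENNReal.ofReal_rpow_of_nonneg dist_nonneg (by positivity),
    ← edist_dist]

theorem measurable_energyDensity (hG : IsOpen G) {u : EuclideanSpace ℝ (Fin n) → ℝ}
    (hu : Measurable u) : Measurable (energyDensity G p δ τ u) := by
  have hS : MeasurableSet {q : EuclideanSpace ℝ (Fin n) × EuclideanSpace ℝ (Fin n) |
      q.2 ∈ G ∧ dist q.2 q.1 < τ * infDist q.1 (frontier G)} := by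
    have h1 : MeasurableSet {q : EuclideanSpace ℝ (Fin n) × EuclideanSpace ℝ (Fin n) |
        dist q.2 q.1 < τ * infDist q.1 (frontier G)} :=
      measurableSet_lt (by fun_prop)
        (((continuous_infDist_pt _).measurable.comp measurable_fst).const_mul _)
    exact (hG.measurableSet.preimage measurable_snd).inter h1
  have heq : energyDensity G p δ τ u = fun x => ∫⁻ y, indicator
      {q : EuclideanSpace ℝ (Fin n) × EuclideanSpace ℝ (Fin n) |
        q.2 ∈ G ∧ dist q.2 q.1 < τ * infDist q.1 (frontier G)}
      (fun q => ‖u q.1 - u q.2‖ₑ ^ p / edist q.1 q.2 ^ (n + δ * p)) (x, y) := by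
    funext x
    rw [energyDensity, ← lintegral_indicator (hG.measurableSet.inter measurableSet_ball)]
    rfl
  rw [heq]
  refine Measurable.lintegral_prod_right (f := fun x y => indicator _ _ (x, y)) ?_
  refine Measurable.indicator (f := fun q : EuclideanSpace ℝ (Fin n) × EuclideanSpace ℝ (Fin n) =>
    ‖u q.1 - u q.2‖ₑ ^ p / edist q.1 q.2 ^ (n + δ * p)) ?_ hS
  fun_prop

/-- Averages over two neighbouring balls of comparable radii. -/
theorem enorm_average_closedBall_sub_le (hn : 1 ≤ n) (hG : IsOpen G)
    (hF : (frontier G).Nonempty) (hp : 1 ≤ p) (hδ : 0 < δ) (hτ : τ ∈ Ioo (0 : ℝ) 1)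
    {u : EuclideanSpace ℝ (Fin n) → ℝ} (hu : LocallyIntegrable u volume)
    {b t ρ : ℝ} {z z' : EuclideanSpace ℝ (Fin n)} (hb : b ∈ Ioc (0 : ℝ) 1) (ht : 0 < t)
    (hρ : ρ ∈ Ioc (0 : ℝ) (τ * b / 8 * t)) (hz : ball z (b * t) ⊆ G)
    (hzz : dist z z' ≤ τ * b / 4 * t) :
    ‖(⨍ x in closedBall z (τ * b / 8 * t), u x) - ⨍ x in closedBall z' ρ, u x‖ₑ ^ p ≤
      (volume (closedBall z (τ * b / 8 * t)))⁻¹ * ((volume (closedBall z' ρ))⁻¹ *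
        (ENNReal.ofReal t ^ (n + δ * p) *
          ∫⁻ x in closedBall z (τ * b / 8 * t), energyDensity G p δ τ u x)) := by
  obtain ⟨hτ0, hτ1⟩ := hτ
  obtain ⟨hb0, hb1⟩ := hb
  obtain ⟨hρ0, hρ1⟩ := hρ
  have hbt : 0 < b * t := by positivity
  have hτb : τ * (b * t) ≤ b * t := mul_le_of_le_one_left hbt.le hτ1.le
  have hτb0 : 0 < τ * (b * t) := by positivity
  have hbt1 : b * t ≤ t := mul_le_of_le_one_left ht.le hb1
  have e8 : τ * b / 8 * t = τ * (b * t) / 8 := by ring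
  have e4 : τ * b / 4 * t = τ * (b * t) / 4 := by ring
  rw [e8] at *
  rw [e4] at *
  have hpos : ∀ (w : EuclideanSpace ℝ (Fin n)) {r : ℝ}, 0 < r → volume (closedBall w r) ≠ 0 :=
    fun w r hr => (measure_closedBall_pos _ w hr).ne'
  -- Radii `1/8`, `1/8` and centre distance `1/4` add up to `1/2`, in units of `τ * b * t`. The
  -- distance from `x` to the boundary is at least `7/8 * (b * t)`, so `y` lies in the ball over
  -- which the energy density integrates.
  have hxy : ∀ x ∈ closedBall z (τ * (b * t) / 8), ∀ y ∈ closedBall z' ρ,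
      dist x y ≤ τ * (b * t) / 2 := by
    intro x hx y hy
    rw [mem_closedBall] at hx hy
    rw [dist_comm] at hy
    linarith [dist_triangle4 x z z' y]
  refine enorm_average_sub_average_rpow_le measurableSet_closedBall measurableSet_closedBall
    (hpos _ (by positivity)) (hpos _ hρ0) measure_closedBall_lt_top.ne measure_closedBall_lt_top.ne
    (hu.integrableOn_isCompact (isCompact_closedBall _ _))
    (hu.integrableOn_isCompact (isCompact_closedBall _ _)) hp (by positivity)
    ENNReal.ofReal_ne_top (fun x hx y hy => ?_) (fun x hx y hy => ⟨hz ?_, ?_⟩)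
  · rw [edist_dist]
    exact ENNReal.ofReal_le_ofReal (by linarith [hxy x hx y hy])
  · rw [mem_closedBall] at hy
    rw [mem_ball]
    rw [dist_comm] at hzz
    linarith [dist_triangle y z' z]
  · rw [mem_closedBall] at hx
    have h1 : b * t - τ * (b * t) / 8 ≤ infDist x (frontier G) :=
      le_infDist_frontier hG hF (Subset.trans (ball_subset_ball' (by linarith)) hz)
    have h2 : τ * (7 / 8 * (b * t)) ≤ τ * infDist x (frontier G) :=
      mul_le_mul_of_nonneg_left (by linarith) hτ0.le
    rw [mem_ball, dist_comm]
    linarith [hxy x hx y hy]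

/-- On the ball `dist x y ≤ 2 * t`, so the kernel of the potential is at least `(2 * t) ^ (-(n - δ /
2))`. -/
theorem lintegral_energyDensity_mul_le {u : EuclideanSpace ℝ (Fin n) → ℝ} (hn : 1 ≤ n)
    (hδ : δ < 1) {x z : EuclideanSpace ℝ (Fin n)} {t ρ : ℝ} (ht : 0 < t) (hρ : ρ ≤ t)
    (hx : dist x z ≤ t) (hz : closedBall z ρ ⊆ G) :
    ENNReal.ofReal ((2 * t) ^ (-(n - δ / 2))) * ∫⁻ y in closedBall z ρ, energyDensity G p δ τ u y ≤
      energyPotential G p δ τ u x := by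
  have hn' : (1 : ℝ) ≤ n := by exact_mod_cast hn
  rw [← lintegral_const_mul' _ _ ENNReal.ofReal_ne_top]
  refine (setLIntegral_mono' measurableSet_closedBall fun y hy => ?_).trans (lintegral_mono_set hz)
  rw [mul_comm]
  gcongr
  rw [← ENNReal.ofReal_rpow_of_pos (by positivity), ENNReal.rpow_neg, ENNReal.rpow_neg]
  refine ENNReal.inv_le_inv.2 (ENNReal.rpow_le_rpow ?_ (by linarith))
  rw [edist_dist]
  rw [mem_closedBall, dist_comm] at hy
  exact ENNReal.ofReal_le_ofReal (by linarith [dist_triangle x z y])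

/-- Exponent count: `δ p - n = δ p / 2 - (n - δ / 2) + δ (p - 1) / 2`. The last power is bounded
because `t ≤ R` and `p ≥ 1`. -/
theorem exists_scale_const {κ l V R : ℝ} (hκ : 0 < κ) (hl : 0 < l) (hV : 0 < V) (hR : 0 < R)
    (hp : 1 ≤ p) (hδ : 0 < δ) (n : ℕ) :
    ∃ C > 0, ∀ t ∈ Ioc 0 R, ((κ * t) ^ n * V)⁻¹ * (((κ * (l * t)) ^ n * V)⁻¹ * t ^ (n + δ * p)) ≤
      C * (t ^ (δ / 2)) ^ p * (2 * t) ^ (-(n - δ / 2)) := by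
  refine ⟨(κ ^ n * V)⁻¹ * ((κ * l) ^ n * V)⁻¹ * R ^ (δ * (p - 1) / 2) * 2 ^ ((n : ℝ) - δ / 2),
    by positivity, fun t ⟨ht, htR⟩ => ?_⟩
  have e1 : t ^ (n + δ * p) = t ^ n * t ^ n * ((t ^ (δ / 2)) ^ p * t ^ (-((n : ℝ) - δ / 2)) *
      t ^ (δ * (p - 1) / 2)) := by
    rw [← Real.rpow_mul ht.le, ← Real.rpow_natCast, ← Real.rpow_add ht, ← Real.rpow_add ht,
      ← Real.rpow_add ht, ← Real.rpow_add ht]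
    congr 1
    ring
  have e2 : (2 : ℝ) ^ ((n : ℝ) - δ / 2) * 2 ^ (-((n : ℝ) - δ / 2)) = 1 := by
    rw [← Real.rpow_add two_pos]
    simp
  have e3 : t ^ (δ * (p - 1) / 2) ≤ R ^ (δ * (p - 1) / 2) :=
    Real.rpow_le_rpow ht.le htR (by have : 0 ≤ p - 1 := by linarith
                                    positivity)
  rw [Real.mul_rpow two_pos.le ht.le]
  set X := (t ^ (δ / 2)) ^ p * t ^ (-((n : ℝ) - δ / 2)) with hX
  calc ((κ * t) ^ n * V)⁻¹ * (((κ * (l * t)) ^ n * V)⁻¹ * t ^ (n + δ * p))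
      = (κ ^ n * V)⁻¹ * ((κ * l) ^ n * V)⁻¹ * t ^ (δ * (p - 1) / 2) * X := by
        rw [e1]
        simp only [mul_pow]
        field_simp
    _ ≤ (κ ^ n * V)⁻¹ * ((κ * l) ^ n * V)⁻¹ * R ^ (δ * (p - 1) / 2) * X := by
        gcongr
    _ = (κ ^ n * V)⁻¹ * ((κ * l) ^ n * V)⁻¹ * R ^ (δ * (p - 1) / 2) * X *
        ((2 : ℝ) ^ ((n : ℝ) - δ / 2) * 2 ^ (-((n : ℝ) - δ / 2))) := by rw [e2, mul_one]
    _ = _ := by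
        rw [hX]
        ring

/-- One step of the chain: the averages at the scales `t` and `l t` differ by at most
`C t ^ (δ / 2)` times a power of the potential. -/
theorem exists_enorm_average_sub_le (hn : 1 ≤ n) (hG : IsOpen G)
    (hF : (frontier G).Nonempty) (hp : 1 ≤ p) (hδ : δ ∈ Ioo (0 : ℝ) 1) (hτ : τ ∈ Ioo (0 : ℝ) 1)
    {b R : ℝ} (hb : b ∈ Ioc (0 : ℝ) 1) (hR : 0 < R) :
    ∃ C : ℝ≥0, ∀ u : EuclideanSpace ℝ (Fin n) → ℝ, LocallyIntegrable u volume →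
      ∀ t ∈ Ioc 0 R, ∀ x z z' : EuclideanSpace ℝ (Fin n), ball z (b * t) ⊆ G →
        dist z z' ≤ τ * b / 4 * t → dist x z ≤ t →
        ‖(⨍ y in closedBall z (τ * b / 8 * t), u y) -
            ⨍ y in closedBall z' (τ * b / 8 * ((1 - τ * b / 4) * t)), u y‖ₑ ≤
          (C * energyPotential G p δ τ u x) ^ (1 / p) * ENNReal.ofReal t ^ (δ / 2) := by
  set V := volume.real (ball (0 : EuclideanSpace ℝ (Fin n)) 1) with hV
  have hV0 : 0 < V := ENNReal.toReal_pos (measure_ball_pos _ _ one_pos).ne' measure_ball_lt_top.ne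
  have hVe : volume (ball (0 : EuclideanSpace ℝ (Fin n)) 1) = ENNReal.ofReal V := by
    rw [hV, ofReal_measureReal measure_ball_lt_top.ne]
  have hτb : τ * b ≤ 1 := mul_le_one₀ hτ.2.le hb.1.le hb.2
  have hτb0 : 0 < τ * b := mul_pos hτ.1 hb.1
  have hl : 0 < 1 - τ * b / 4 := by linarith
  obtain ⟨C, hC, hscale⟩ := exists_scale_const (κ := τ * b / 8) (l := 1 - τ * b / 4) (V := V)
    (by positivity) hl hV0 hR hp hδ.1 n
  refine ⟨C.toNNReal, fun u hu t ht x z z' hz hzz hx => ?_⟩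
  obtain ⟨ht0, htR⟩ := ht
  have hκt : 0 < τ * b / 8 * t := by positivity
  have hvol : ∀ (w : EuclideanSpace ℝ (Fin n)) {r : ℝ}, 0 < r →
      (volume (closedBall w r))⁻¹ = ENNReal.ofReal (r ^ n * V)⁻¹ := by
    intro w r hr
    rw [Measure.addHaar_closedBall _ _ hr.le, hVe, ← ENNReal.ofReal_mul (by positivity),
      finrank_euclideanSpace_fin, ENNReal.ofReal_inv_of_pos (by positivity)]
  have hρ : τ * b / 8 * ((1 - τ * b / 4) * t) ∈ Ioc 0 (τ * b / 8 * t) :=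
    ⟨by positivity, mul_le_mul_of_nonneg_left (mul_le_of_le_one_left ht0.le (by linarith))
      (by positivity)⟩
  have hstep := enorm_average_closedBall_sub_le (p := p) (δ := δ) hn hG hF hp hδ.1 hτ hu hb ht0 hρ
    hz hzz
  have hsub : closedBall z (τ * b / 8 * t) ⊆ G := by
    refine (closedBall_subset_ball ?_).trans hz
    have h1 := mul_lt_of_lt_one_left (mul_pos hb.1 ht0) hτ.2
    have h2 : 0 < b * t := mul_pos hb.1 ht0
    have h3 : τ * b / 8 * t = τ * (b * t) / 8 := by ring
    linarith
  have hpot := lintegral_energyDensity_mul_le (p := p) (τ := τ) (u := u) hn hδ.2 ht0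
    (mul_le_of_le_one_left ht0.le (by linarith)) hx hsub
  have hp0 : 0 < p := by linarith
  set X := ‖(⨍ y in closedBall z (τ * b / 8 * t), u y) -
            ⨍ y in closedBall z' (τ * b / 8 * ((1 - τ * b / 4) * t)), u y‖ₑ
  have hXp : X ^ p ≤ C.toNNReal * energyPotential G p δ τ u x * (ENNReal.ofReal t ^ (δ / 2)) ^ p := by
    refine hstep.trans ?_
    rw [hvol _ hκt, hvol _ hρ.1, ENNReal.ofReal_rpow_of_pos ht0, ← mul_assoc, ← mul_assoc,
      ← ENNReal.ofReal_mul (by positivity), ← ENNReal.ofReal_mul (by positivity), mul_assoc]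
    calc _ ≤ ENNReal.ofReal (C * (t ^ (δ / 2)) ^ p * (2 * t) ^ (-(n - δ / 2))) *
          ∫⁻ y in closedBall z (τ * b / 8 * t), energyDensity G p δ τ u y := by
          exact mul_le_mul' (ENNReal.ofReal_le_ofReal (hscale t ⟨ht0, htR⟩)) le_rfl
      _ = ENNReal.ofReal (C * (t ^ (δ / 2)) ^ p) * (ENNReal.ofReal ((2 * t) ^ (-(n - δ / 2))) *
          ∫⁻ y in closedBall z (τ * b / 8 * t), energyDensity G p δ τ u y) := by
          rw [ENNReal.ofReal_mul (by positivity), mul_assoc]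
      _ ≤ ENNReal.ofReal (C * (t ^ (δ / 2)) ^ p) * energyPotential G p δ τ u x := by gcongr
      _ = _ := by
          rw [ENNReal.ofReal_mul hC.le, ENNReal.ofReal_rpow_of_pos ht0,
            ENNReal.ofReal_rpow_of_pos (by positivity)]
          simp only [ENNReal.ofReal]
          ring
  calc X = (X ^ p) ^ (1 / p) := by
        rw [← ENNReal.rpow_mul, mul_one_div_cancel hp0.ne', ENNReal.rpow_one]
    _ ≤ _ := ENNReal.rpow_le_rpow hXp (by positivity)
    _ = _ := by
        rw [ENNReal.mul_rpow_of_nonneg _ _ (by positivity : 0 ≤ 1 / p), ← ENNReal.rpow_mul (_ ^ _),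
          mul_one_div_cancel hp0.ne', ENNReal.rpow_one]

/-- In a John domain the deviation of a function from a fixed average is pointwise controlled by
the potential of its energy density. -/
theorem IsJohn.exists_enorm_sub_rpow_le (hJ : IsJohn G) (hn : 1 ≤ n) (hG : IsOpen G)
    (hF : (frontier G).Nonempty) (hp : 1 ≤ p) (hδ : δ ∈ Ioo (0 : ℝ) 1) (hτ : τ ∈ Ioo (0 : ℝ) 1) :
    ∃ C : ℝ≥0, ∀ u : EuclideanSpace ℝ (Fin n) → ℝ, LocallyIntegrable u volume →
      ∃ a : ℝ, ∀ᵐ x, x ∈ G → ‖u x - a‖ₑ ^ p ≤ C * energyPotential G p δ τ u x := by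
  obtain ⟨x₀, R, c, hR, hc, hcurves⟩ := hJ
  set b := min c 1 with hb
  have hb0 : 0 < b := by positivity
  have hb1 : b ≤ 1 := min_le_right _ _
  obtain ⟨C, hC⟩ := exists_enorm_average_sub_le (τ := τ) hn hG hF hp hδ hτ ⟨hb0, hb1⟩ hR
  have hτb : τ * b ≤ 1 := mul_le_one₀ hτ.2.le hb0.le hb1
  have hτb0 : 0 < τ * b := mul_pos hτ.1 hb0
  -- As `γ` is `1`-Lipschitz, passing from scale `t` to `l * t` moves the centre by at most `τ * b /
  -- 4 * t`, exactly what one step of the chain allows.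
  set l := 1 - τ * b / 4 with hl
  have hl0 : 0 < l := by linarith
  have hl1 : l < 1 := by linarith
  set κ := τ * b / 8 with hκ
  have hκ0 : 0 < κ := by positivity
  have hp0 : 0 < p := by linarith
  set S : ℝ≥0∞ := ∑' k : ℕ, ENNReal.ofReal (R * l ^ k) ^ (δ / 2) with hS
  have hStop : S ≠ ∞ := by
    have hq : ENNReal.ofReal l ^ (δ / 2) < 1 :=
      ENNReal.rpow_lt_one (by simpa using hl1) (by linarith [hδ.1])
    have : S = ENNReal.ofReal R ^ (δ / 2) * (1 - ENNReal.ofReal l ^ (δ / 2))⁻¹ := by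
      rw [hS, ← ENNReal.tsum_geometric, ← ENNReal.tsum_mul_left]
      refine tsum_congr fun k => ?_
      rw [ENNReal.ofReal_mul hR.le, ENNReal.mul_rpow_of_nonneg _ _ (by linarith [hδ.1]),
        ENNReal.ofReal_pow hl0.le, ← ENNReal.rpow_natCast, ← ENNReal.rpow_natCast,
        ← ENNReal.rpow_mul, ← ENNReal.rpow_mul, mul_comm (k : ℝ)]
    rw [this]
    refine ENNReal.mul_ne_top
      (ENNReal.rpow_ne_top_of_nonneg (by linarith [hδ.1]) ENNReal.ofReal_ne_top) ?_
    simpa [tsub_eq_zero_iff_le] using hq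
  have hSp : S ^ p ≠ ∞ := by simp [hStop, hp0.le]
  refine ⟨C * (S ^ p).toNNReal, fun u hu => ⟨⨍ y in closedBall x₀ (κ * R), u y, ?_⟩⟩
  -- The balls are not centred at `x`; the dilation factor `κ⁻¹` suffices since `dist x (γ t) ≤ t =
  -- κ⁻¹ * (κ * t)`.
  filter_upwards [IsUnifLocDoublingMeasure.ae_tendsto_average volume hu κ⁻¹] with x hleb hxG
  obtain ⟨γ, hγ, hγ0, hγR, hγG⟩ := hcurves x hxG
  have ht : ∀ k : ℕ, R * l ^ k ∈ Ioc 0 R := fun k =>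
    ⟨by positivity, mul_le_of_le_one_right hR.le (pow_le_one₀ hl0.le hl1.le)⟩
  have hdist : ∀ t ∈ Ioc 0 R, dist x (γ t) ≤ t := by
    intro t ht
    have := hγ.dist_le_mul 0 ⟨le_rfl, hR.le⟩ t ⟨ht.1.le, ht.2⟩
    simpa [hγ0, abs_of_pos ht.1] using this
  have hlim : Tendsto (fun k : ℕ => ⨍ y in closedBall (γ (R * l ^ k)) (κ * (R * l ^ k)), u y)
      atTop (𝓝 (u x)) := by
    refine hleb (fun k : ℕ => γ (R * l ^ k)) (fun k => κ * (R * l ^ k)) ?_ ?_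
    · refine tendsto_nhdsWithin_iff.2 ⟨?_, Eventually.of_forall fun k => ?_⟩
      · simpa using ((tendsto_pow_atTop_nhds_zero_of_lt_one hl0.le hl1).const_mul R).const_mul κ
      · exact mul_pos hκ0 (ht k).1
    · refine Eventually.of_forall fun k => ?_
      rw [mem_closedBall, inv_mul_cancel_left₀ hκ0.ne']
      exact hdist _ (ht k)
  have hsum := edist_le_tsum_of_edist_le_of_tendsto₀
    (fun k : ℕ => (C * energyPotential G p δ τ u x) ^ (1 / p) *
      ENNReal.ofReal (R * l ^ k) ^ (δ / 2)) (fun k => by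
      rw [edist_eq_enorm_sub, Nat.succ_eq_add_one,
        show R * l ^ (k + 1) = l * (R * l ^ k) by ring]
      refine hC u hu _ (ht k) x _ _ ?_ ?_ (hdist _ (ht k))
      · exact (ball_subset_ball (mul_le_mul_of_nonneg_right (min_le_left _ _) (ht k).1.le)).trans
          (hγG _ ⟨(ht k).1.le, (ht k).2⟩)
      · have hk := ht k
        have hk' := ht (k + 1)
        rw [show R * l ^ (k + 1) = l * (R * l ^ k) by ring] at hk'
        have := hγ.dist_le_mul _ ⟨hk.1.le, hk.2⟩ _ ⟨hk'.1.le, hk'.2⟩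
        refine this.trans (le_of_eq ?_)
        have e : R * l ^ k - l * (R * l ^ k) = τ * b / 4 * (R * l ^ k) := by
          rw [hl]
          ring
        rw [NNReal.coe_one, one_mul, Real.dist_eq, e, abs_of_pos (mul_pos (by positivity) hk.1)])
    hlim
  rw [ENNReal.tsum_mul_left, ← hS, edist_comm, edist_eq_enorm_sub, pow_zero, mul_one, hγR] at hsum
  calc _ ≤ ((C * energyPotential G p δ τ u x) ^ (1 / p) * S) ^ p :=
        ENNReal.rpow_le_rpow hsum hp0.le
    _ = C * energyPotential G p δ τ u x * S ^ p := by
        rw [ENNReal.mul_rpow_of_nonneg _ _ hp0.le, ← ENNReal.rpow_mul,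
          one_div_mul_cancel hp0.ne', ENNReal.rpow_one]
    _ = _ := by
        rw [ENNReal.coe_mul, ENNReal.coe_toNNReal hSp]
        ring

/-! ### Integration of the pointwise bound. -/

theorem exists_lintegral_energyPotential_le (hn : 1 ≤ n) (hG : IsOpen G)
    (hGb : Bornology.IsBounded G) (hδ : δ ∈ Ioo (0 : ℝ) 1) :
    ∃ C : ℝ≥0, ∀ u : EuclideanSpace ℝ (Fin n) → ℝ, Measurable u →
      ∫⁻ x in G, energyPotential G p δ τ u x ≤ C * ∫⁻ y in G, energyDensity G p δ τ u y := by
  obtain ⟨C, hC⟩ := exists_lintegral_edist_rpow_le hn hGb (α := n - δ / 2)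
    (by linarith [hδ.1])
  refine ⟨C, fun u hu => ?_⟩
  have hg := measurable_energyDensity (p := p) (δ := δ) (τ := τ) hG hu
  unfold energyPotential
  rw [lintegral_lintegral_swap, ← lintegral_const_mul _ hg]
  · refine setLIntegral_mono' hG.measurableSet fun y hy => ?_
    rw [lintegral_const_mul _ (by fun_prop), mul_comm]
    gcongr
    exact hC y hy
  · refine Measurable.aemeasurable ?_
    exact Measurable.mul (hg.comp measurable_snd) (by fun_prop)

theorem fracEnergy_congr {u v : EuclideanSpace ℝ (Fin n) → ℝ}
    (h : u =ᵐ[volume.restrict G] v) : fracEnergy G p δ τ u = fracEnergy G p δ τ v := by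
  refine lintegral_congr_ae ?_
  filter_upwards [h] with x hx
  refine lintegral_congr_ae ?_
  filter_upwards [ae_restrict_of_ae_restrict_of_subset inter_subset_left h] with y hy
  rw [hx, hy]

theorem IsJohn.supportsFracPoincare (hJ : IsJohn G) (hn : 1 ≤ n) (hG : IsOpen G)
    (hne : G.Nonempty) (hGb : Bornology.IsBounded G) (hp : 1 ≤ p) (hδ : δ ∈ Ioo (0 : ℝ) 1)
    (hτ : τ ∈ Ioo (0 : ℝ) 1) : SupportsFracPoincare G p p δ τ := by
  have : Nontrivial (EuclideanSpace ℝ (Fin n)) :=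
    Module.nontrivial_of_finrank_pos (R := ℝ) (by rwa [finrank_euclideanSpace_fin])
  have hp0 : 0 < p := by linarith
  have hF := frontier_nonempty_of_isBounded hne hGb
  obtain ⟨C₁, hC₁⟩ := hJ.exists_enorm_sub_rpow_le hn hG hF hp hδ hτ
  obtain ⟨C₂, hC₂⟩ := exists_lintegral_energyPotential_le (p := p) (τ := τ) hn hG hGb hδ
  have : IsFiniteMeasure (volume.restrict G) := ⟨by simpa using hGb.measure_lt_top⟩
  have : NeZero (volume.restrict G) := ⟨by simpa using (hG.measure_pos volume hne).ne'⟩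
  have hp1 : (1 : ℝ≥0∞) ≤ ENNReal.ofReal p := ENNReal.one_le_ofReal.2 hp
  refine ⟨2 ^ p * (C₁ * C₂), fun u hu => ?_⟩
  -- A measurable representative extended by zero is locally integrable on the whole space, as
  -- Lebesgue differentiation requires, and measurable, as Tonelli requires. Neither side of the
  -- inequality changes.
  set v := G.indicator (hu.1.mk u) with hv
  have hvu : u =ᵐ[volume.restrict G] v :=
    hu.1.ae_eq_mk.trans (indicator_ae_eq_restrict hG.measurableSet).symm
  have hvm : Measurable v := hu.1.stronglyMeasurable_mk.measurable.indicator hG.measurableSet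
  have hvLp : MemLp v (ENNReal.ofReal p) volume := by
    rw [hv, memLp_indicator_iff_restrict hG.measurableSet]
    exact (memLp_congr_ae hu.1.ae_eq_mk).1 hu
  have hvloc := hvLp.locallyIntegrable hp1
  have hvint : Integrable v (volume.restrict G) := (hvLp.restrict G).integrable hp1
  obtain ⟨a, ha⟩ := hC₁ v hvloc
  rw [div_self hp0.ne', ENNReal.rpow_one, fracEnergy_congr hvu,
    fracEnergy_eq_lintegral_energyDensity hp0.le hδ.1.le]
  calc ∫⁻ x in G, ENNReal.ofReal (|u x - ⨍ y in G, u y| ^ p)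
      = ∫⁻ x in G, ‖v x - ⨍ y in G, v y‖ₑ ^ p := by
        rw [average_congr hvu]
        refine lintegral_congr_ae ?_
        filter_upwards [hvu] with x hx
        rw [hx, ofReal_abs_rpow hp0.le]
    _ ≤ 2 ^ p * ∫⁻ x in G, ‖v x - a‖ₑ ^ p := lintegral_enorm_sub_average_rpow_le hvint a hp
    _ ≤ 2 ^ p * ∫⁻ x in G, C₁ * energyPotential G p δ τ v x := by
        gcongr 2 ^ p * ?_
        exact lintegral_mono_ae ((ae_restrict_iff' hG.measurableSet).2 ha)
    _ ≤ 2 ^ p * (C₁ * (C₂ * ∫⁻ y in G, energyDensity G p δ τ v y)) := by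
        rw [lintegral_const_mul' _ _ ENNReal.coe_ne_top]
        gcongr
        exact hC₂ v hvm
    _ = _ := by
        rw [ENNReal.coe_mul, ENNReal.coe_mul, ENNReal.coe_rpow_of_nonneg _ hp0.le]
        simp only [mul_assoc, ENNReal.coe_ofNat]

end PointwiseBound

end FracPoincare

end FractionalPoincare

theorem corollary4p3 (n : ℕ) (hn : 2 ≤ n) (G : Set (EuclideanSpace ℝ (Fin n)))
    (hG_open : IsOpen G) (hG_conn : IsConnected G) (hG_bdd : Bornology.IsBounded G)
    (p δ τ : ℝ) (hp : 1 ≤ p) (hδ : δ ∈ Set.Ioo (0 : ℝ) 1) (hτ : τ ∈ Set.Ioo (0 : ℝ) 1)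
    (hG : FracPoincare.IsUniformDomain G ∨ FracPoincare.IsLipschitzDomain G) :
    FracPoincare.SupportsFracPoincare G p p δ τ := by
  have hn1 : 1 ≤ n := by omega
  have hJ : FracPoincare.IsJohn G := hG.elim (fun h => h.isJohn hG_bdd) fun h => h.isJohn hG_bdd
  exact hJ.supportsFracPoincare hn1 hG_open hG_conn.nonempty hG_bdd hp hδ hτ
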